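/- Let $n\ge 1$ and $0\le k\le n$ be integers and let $\Omega\subset\mathbb{R}^n$ be a nonempty bounded open set. Write $\Lambda^l=\Lambda^l(\mathbb{R}^n)$, with the scalar product for which the forms $dx^{i_1}\wedge\cdots\wedge dx^{i_l}$, $i_1<\cdots<i_l$, are orthonormal ($\Lambda^{-1}=\Lambda^{n+1}=\{0\}$). For $\omega\in W^{1,2}(\Omega;\Lambda^l)$ with weak partial derivatives $\omega_{x_j}$, let $|\nabla\omega|^2=\sum_j|\omega_{x_j}|^2$, let $d\omega=\sum_j dx^j\wedge\omega_{x_j}\in L^2(\Omega;\Lambda^{l+1})$ be the exterior derivative and $\delta\omega=\sum_j dx^j\,\lrcorner\,\omega_{x_j}\in L^2(\Omega;\Lambda^{l-1})$ the interior derivative (so $\delta$ is the divergence on $1$-forms), and let $\|\cdot\|$ be the $L^2(\Omega)$-norm. Let $W_T^{1,2}(\Omega;\Lambda^k)$ be the space of all $\omega\in W^{1,2}(\Omega;\Lambda^k)$ with $\nu\wedge\omega=0$ on $\partial\Omega$, in the weak sense that $$\int_\Omega\big(\langle d\omega;\varphi\rangle+\langle\omega;\delta\varphi\rangle\big)=0\qquad\text{for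 all }\varphi\in W^{1,2}(\Omega;\Lambda^{k+1}),$$ and let $W_N^{1,2}(\Omega;\Lambda^k)$ be the space of all $\omega\in W^{1,2}(\Omega;\Lambda^k)$ with $\nu\,\lrcorner\,\omega=0$ on $\partial\Omega$, in the weak sense that $$\int_\Omega\big(\langle \delta\omega;\varphi\rangle+\langle\omega;d\varphi\rangle\big)=0\qquad\text{for all }\varphi\in W^{1,2}(\Omega;\Lambda^{k-1}).$$ (If $\partial\Omega$ is Lipschitz with outward unit normal $\nu$, these conditions say that the traces of $\nu\wedge\omega$, respectively $\nu\,\lrcorner\,\omega$, vanish on $\partial\Omega$.) Define, in $[0,\infty]$, $$C_T(\Omega,k)=\sup_{\omega\in W_T^{1,2}(\Omega;\Lambda^k)\setminus\{0\}}\frac{\|\nabla\omega\|^2}{\|d\omega\|^2+\|\delta\omega\|^2+\|\omega\|^2},\qquad C_N(\Omega,k)=\sup_{\omega\in W_N^{1,2}(\Omega;\Lambda^k)\setminus\{0\}}\frac{\|\nabla\omega\|^2}{\|d\omega\|^2+\|\delta\omega\|^2+\|\omega\|^2}.$$ Then $C_T(\Omega,k)\ge1$ and $C_N(\Omega,k)\ge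 1$. Moreover $$C_T(\Omega,0)=C_N(\Omega,0)=C_T(\Omega,n)=C_N(\Omega,n)=1\quad\text{and}\quad C_T(\Omega,k)=C_N(\Omega,n-k).$$ -/

import Mathlib

open MeasureTheory
open scoped ENNReal

namespace Gaffney

noncomputable section

/-- The Euclidean space `ℝⁿ`. -/
abbrev Space (n : ℕ) : Type := EuclideanSpace ℝ (Fin n)

/-- The exterior algebra `Λ(ℝⁿ) = ⨁ₖ Λᵏ(ℝⁿ)` in coordinates: the component of `ω` at the finite set
`I = {i₁ < ⋯ < iₖ}` is the coefficient `ω^{i₁⋯iₖ}` of `dx^{i₁} ∧ ⋯ ∧ dx^{iₖ}`. The inner product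
and the norm are the usual ones, for which these basis forms are orthonormal. -/
abbrev Ext (n : ℕ) : Type := EuclideanSpace ℝ (Finset (Fin n))

/-- `ω` is homogeneous of degree `k`, that is, `ω ∈ Λᵏ(ℝⁿ)`. -/
def IsHomogeneous {n : ℕ} (k : ℕ) (ω : Ext n) : Prop :=
  ∀ I : Finset (Fin n), I.card ≠ k → ω I = 0

/-- The sign `(-1)^m`, where `m` is the number of elements of `I` that are smaller than `j`. For
`j = i_γ` in `I = {i₁ < ⋯ < iₖ}` this is `(-1)^(γ-1)`; for `j ∉ I` it is the sign for which
`dx^j ∧ dx^I = sign j I • dx^(I ∪ {j})`. -/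
def sign {n : ℕ} (j : Fin n) (I : Finset (Fin n)) : ℝ :=
  (-1) ^ (I.filter (fun i => i < j)).card

/-- The exterior derivative `dω = ∑ⱼ dx^j ∧ ∂ⱼω`, as a function of the first derivatives
`D j = ∂ⱼω`:
`(dω)^{i₁⋯iₖ₊₁} = ∑_γ (-1)^(γ-1) ∂_{i_γ} ω^{i₁⋯i_{γ-1}i_{γ+1}⋯iₖ₊₁}`. -/
def extD {n : ℕ} (D : Fin n → Ext n) : Ext n :=
  WithLp.toLp 2 fun J => ∑ j ∈ J, sign j J * D j (J.erase j)

/-- The interior derivative `δω = ∑ⱼ dx^j ⌟ ∂ⱼω`, as a function of the first derivatives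
`D j = ∂ⱼω`:
`(δω)^{i₁⋯iₖ₋₁} = ∑ⱼ ∂ⱼ ω^{j i₁⋯iₖ₋₁}`, where `ω^{j i₁⋯iₖ₋₁}` vanishes when `j` is one of the `iₗ`
and is `sign j I` times the component at `I ∪ {j}` otherwise. -/
def coD {n : ℕ} (D : Fin n → Ext n) : Ext n :=
  WithLp.toLp 2 fun I => ∑ j ∈ Iᶜ, sign j I * D j (insert j I)

/-- `g` is the weak partial derivative `∂ⱼf` in `Ω`:
`∫_Ω f ∂ⱼφ = - ∫_Ω g φ` for all `φ ∈ C_c^∞(Ω)`. -/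
def IsWeakPartial {n : ℕ} (Ω : Set (Space n)) (j : Fin n) (f g : Space n → Ext n) : Prop :=
  ∀ φ : Space n → ℝ, ContDiff ℝ ((⊤ : ℕ∞) : WithTop ℕ∞) φ → HasCompactSupport φ → tsupport φ ⊆ Ω →
    ∫ x in Ω, (fderiv ℝ φ x (EuclideanSpace.single j 1)) • f x = - ∫ x in Ω, φ x • g x

/-- An element of the Sobolev space `W^{1,2}(Ω; Λᵏ)`, together with its weak gradient (which it
determines almost everywhere in `Ω`). -/
structure SobolevForm {n : ℕ} (Ω : Set (Space n)) (k : ℕ) where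
  /-- the form `ω` itself -/
  toFun : Space n → Ext n
  /-- the weak partial derivatives `∂ⱼω` -/
  grad : Fin n → Space n → Ext n
  homogeneous : ∀ x, IsHomogeneous k (toFun x)
  grad_homogeneous : ∀ j x, IsHomogeneous k (grad j x)
  memLp : MemLp toFun 2 (volume.restrict Ω)
  grad_memLp : ∀ j, MemLp (grad j) 2 (volume.restrict Ω)
  isWeakPartial : ∀ j, IsWeakPartial Ω j toFun (grad j)

namespace SobolevForm

variable {n k : ℕ} {Ω : Set (Space n)}

/-- The exterior derivative `dω`. -/
def d (ω : SobolevForm Ω k) (x : Space n) : Ext n := extD fun j => ω.grad j x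

/-- The interior derivative `δω`. -/
def δ (ω : SobolevForm Ω k) (x : Space n) : Ext n := coD fun j => ω.grad j x

/-- `ω` is nonzero as an element of `W^{1,2}(Ω; Λᵏ)`. -/
def IsNonzero (ω : SobolevForm Ω k) : Prop := ¬ ω.toFun =ᵐ[volume.restrict Ω] 0

/-- The boundary condition `ν ∧ ω = 0` on `∂Ω`, in the weak sense given by the Green formula
`∫_Ω (⟨dω; φ⟩ + ⟨ω; δφ⟩) = ∫_{∂Ω} ⟨ν ∧ ω; φ⟩`: the left-hand side vanishes for every
`φ ∈ W^{1,2}(Ω; Λ^{k+1})`. It makes sense for every open `Ω`, and says that the trace of `ν ∧ ω`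
is zero when `∂Ω` is Lipschitz. -/
def IsTangential (ω : SobolevForm Ω k) : Prop :=
  ∀ φ : SobolevForm Ω (k + 1),
    ∫ x in Ω, (inner ℝ (ω.d x) (φ.toFun x) + inner ℝ (ω.toFun x) (φ.δ x)) = 0

/-- The boundary condition `ν ⌟ ω = 0` on `∂Ω`, in the weak sense given by the Green formula
`∫_Ω (⟨δω; φ⟩ + ⟨ω; dφ⟩) = ∫_{∂Ω} ⟨ν ⌟ ω; φ⟩`: the left-hand side vanishes for every
`φ ∈ W^{1,2}(Ω; Λ^{k-1})` (there is no condition when `k = 0`). -/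
def IsNormal (ω : SobolevForm Ω k) : Prop :=
  ∀ l : ℕ, l + 1 = k → ∀ φ : SobolevForm Ω l,
    ∫ x in Ω, (inner ℝ (ω.δ x) (φ.toFun x) + inner ℝ (ω.toFun x) (φ.d x)) = 0

end SobolevForm

/-- The squared norm `‖f‖²` in `L²(Ω)`. -/
def normSq {n : ℕ} (Ω : Set (Space n)) (f : Space n → Ext n) : ℝ≥0∞ :=
  ∫⁻ x in Ω, ‖f x‖ₑ ^ 2

/-- The quotient `‖∇ω‖² / (‖dω‖² + ‖δω‖² + ‖ω‖²)`. -/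
def quotient {n k : ℕ} {Ω : Set (Space n)} (ω : SobolevForm Ω k) : ℝ≥0∞ :=
  (∑ j, normSq Ω (ω.grad j)) / (normSq Ω ω.d + normSq Ω ω.δ + normSq Ω ω.toFun)

/-- The best constant `C_T(Ω, k) ∈ [0, ∞]`: the supremum of the quotient over
`W_T^{1,2}(Ω; Λᵏ) \ {0}`. -/
def bestT {n : ℕ} (Ω : Set (Space n)) (k : ℕ) : ℝ≥0∞ :=
  ⨆ (ω : SobolevForm Ω k) (_ : ω.IsTangential) (_ : ω.IsNonzero), quotient ω

/-- The best constant `C_N(Ω, k) ∈ [0, ∞]`: the supremum of the quotient over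
`W_N^{1,2}(Ω; Λᵏ) \ {0}`. -/
def bestN {n : ℕ} (Ω : Set (Space n)) (k : ℕ) : ℝ≥0∞ :=
  ⨆ (ω : SobolevForm Ω k) (_ : ω.IsNormal) (_ : ω.IsNonzero), quotient ω

end

end Gaffney

namespace Gaffney

noncomputable section

variable {n : ℕ}

/-! ### The exterior algebra -/

/-! For the lower bound, take `ω = f dx^I` with `f` a test function. The derivatives `∂ⱼf` with `j ∉
I` appear only in `dω`, those with `j ∈ I` only in `δω`, each on its own basis form, so `|dω|² +
|δω|² = |∇ω|²` pointwise (`norm_sq_extD_add_norm_sq_coD_basisForm`). The quotient then falls short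
of `1` only through `‖ω‖²`, and a Poincaré inequality (`integral_sq_le`) makes that term negligible
when `f` lives in a small ball.

In degree zero `|dω| = |∇ω|` pointwise, which gives the upper bound `1`.

The Hodge star is a pointwise isometry that commutes with weak derivatives and exchanges `d` with
`δ` and the two boundary conditions (`bestT_eq_bestN`). It carries the bounds from the tangential to
the normal problem and from degree `0` to degree `n`. -/

lemma sign_mul_self (j : Fin n) (I : Finset (Fin n)) : sign j I * sign j I = 1 := by
  unfold sign
  rw [← pow_add, ← two_mul, pow_mul]
  simp

lemma sign_erase (j : Fin n) (J : Finset (Fin n)) : sign j (J.erase j) = sign j J := by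
  unfold sign
  congr 2
  ext i
  simp only [Finset.mem_filter, Finset.mem_erase]
  constructor
  · rintro ⟨⟨_, h⟩, h'⟩
    exact ⟨h, h'⟩
  · rintro ⟨h, h'⟩
    exact ⟨⟨h'.ne, h⟩, h'⟩

lemma sign_insert (j : Fin n) (I : Finset (Fin n)) : sign j (insert j I) = sign j I := by
  rw [← sign_erase j (insert j I), Finset.erase_insert_eq_erase, sign_erase]

/-- The elements below `j` in `I` and in `Iᶜ` together make up `Iio j`. This is the sign by which
`hodgeSign` changes when `j` is inserted. -/
lemma sign_mul_sign_compl (j : Fin n) (I : Finset (Fin n)) :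
    sign j I * sign j Iᶜ = (-1) ^ (j : ℕ) := by
  unfold sign
  rw [← pow_add, ← Finset.card_union_of_disjoint, ← Finset.filter_union, Finset.union_compl]
  · congr 1
    have : (Finset.univ.filter fun i : Fin n => i < j) = Finset.Iio j := by ext; simp
    rw [this, Fin.card_Iio]
  · exact Finset.disjoint_filter_filter disjoint_compl_right

lemma compl_insert_eq (j : Fin n) (I : Finset (Fin n)) : (insert j I)ᶜ = Iᶜ.erase j :=
  Finset.compl_insert

lemma compl_erase_eq (j : Fin n) (I : Finset (Fin n)) : (I.erase j)ᶜ = insert j Iᶜ :=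
  Finset.compl_erase

/-- The sign in the definition of the Hodge star operator. -/
def hodgeSign (I : Finset (Fin n)) : ℝ := (-1) ^ (∑ i ∈ I, (i : ℕ))

lemma hodgeSign_mul_self (I : Finset (Fin n)) : hodgeSign I * hodgeSign I = 1 := by
  unfold hodgeSign
  rw [← pow_add, ← two_mul, pow_mul]
  simp

lemma hodgeSign_insert {j : Fin n} {I : Finset (Fin n)} (h : j ∉ I) :
    hodgeSign (insert j I) = (-1) ^ (j : ℕ) * hodgeSign I := by
  unfold hodgeSign
  rw [Finset.sum_insert h, pow_add]

lemma hodgeSign_compl (I : Finset (Fin n)) :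
    hodgeSign Iᶜ = hodgeSign (Finset.univ : Finset (Fin n)) * hodgeSign I := by
  have : hodgeSign (Finset.univ : Finset (Fin n)) = hodgeSign I * hodgeSign Iᶜ := by
    unfold hodgeSign
    rw [← pow_add, Finset.sum_add_sum_compl]
  rw [this, mul_right_comm, hodgeSign_mul_self, one_mul]

/-- The Hodge star operator, up to a sign depending on the degree only. -/
def hodge (n : ℕ) : Ext n →ₗᵢ[ℝ] Ext n where
  toFun ω := WithLp.toLp 2 fun I => hodgeSign I * ω Iᶜ
  map_add' a b := by ext I; simp [mul_add]
  map_smul' c a := by ext I; simp [mul_left_comm]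
  norm_map' ω := by
    refine (sq_eq_sq₀ (norm_nonneg _) (norm_nonneg _)).1 ?_
    rw [EuclideanSpace.real_norm_sq_eq, EuclideanSpace.real_norm_sq_eq]
    refine Finset.sum_bij' (fun I _ => Iᶜ) (fun I _ => Iᶜ) (by simp) (by simp) (by simp) (by simp) ?_
    intro I _
    have := hodgeSign_mul_self I
    simp only [LinearMap.coe_mk, AddHom.coe_mk]
    linear_combination (ω Iᶜ) ^ 2 * this

lemma hodge_apply (ω : Ext n) (I : Finset (Fin n)) : hodge n ω I = hodgeSign I * ω Iᶜ := rfl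

lemma hodge_homogeneous {k m : ℕ} (hkm : k + m = n) {ω : Ext n} (h : IsHomogeneous k ω) :
    IsHomogeneous m (hodge n ω) := by
  intro I hI
  rw [hodge_apply, h, mul_zero]
  have := Finset.card_add_card_compl I
  rw [Fintype.card_fin] at this
  omega

lemma inner_ext (a b : Ext n) : inner ℝ a b = ∑ I, a I * b I := by
  rw [PiLp.inner_apply]
  exact Finset.sum_congr rfl fun I _ => by simp [mul_comm]

/-- The sign left over does not depend on the forms, so it factors out of the Green integrals, where
only vanishing matters. -/
lemma inner_hodge_left (a b : Ext n) :
    inner ℝ (hodge n a) b = hodgeSign (Finset.univ : Finset (Fin n)) * inner ℝ a (hodge n b) := by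
  rw [inner_ext, inner_ext, Finset.mul_sum]
  refine Finset.sum_bij' (fun I _ => Iᶜ) (fun I _ => Iᶜ) (by simp) (by simp) (by simp) (by simp) ?_
  intro I _
  rw [hodge_apply, hodge_apply, hodgeSign_compl, compl_compl]
  linear_combination
    (-(a Iᶜ * b I * hodgeSign I)) * hodgeSign_mul_self (Finset.univ : Finset (Fin n))

/-- Inserting `j` into `I` is erasing it from `Iᶜ`; the factor `(-1)^j` from `hodgeSign` exactly
compensates the two values of `sign`, so no sign remains. -/
lemma coD_hodge (D : Fin n → Ext n) : coD (fun j => hodge n (D j)) = hodge n (extD D) := by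
  ext I
  rw [hodge_apply]
  simp only [coD, extD, hodge_apply, Finset.mul_sum]
  refine Finset.sum_congr rfl fun j hj => ?_
  rw [hodgeSign_insert (Finset.mem_compl.1 hj), compl_insert_eq, ← sign_mul_sign_compl j I]
  linear_combination (sign j Iᶜ * hodgeSign I * D j (Iᶜ.erase j)) * sign_mul_self j I

lemma extD_hodge (D : Fin n → Ext n) : extD (fun j => hodge n (D j)) = hodge n (coD D) := by
  ext I
  rw [hodge_apply]
  simp only [coD, extD, hodge_apply, Finset.mul_sum, compl_compl]
  refine Finset.sum_congr rfl fun j hj => ?_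
  have h : hodgeSign I = (-1) ^ (j : ℕ) * hodgeSign (I.erase j) := by
    rw [← hodgeSign_insert (Finset.notMem_erase j I), Finset.insert_erase hj]
  rw [h, compl_erase_eq, ← sign_mul_sign_compl j I]
  linear_combination
    (-(sign j I * hodgeSign (I.erase j) * D j (insert j Iᶜ))) * sign_mul_self j Iᶜ

lemma sum_erase_eq_sum_insert (F : Fin n → Finset (Fin n) → Finset (Fin n) → ℝ) :
    ∑ J, ∑ j ∈ J, F j J (J.erase j) = ∑ I, ∑ j ∈ Iᶜ, F j (insert j I) I := by
  rw [Finset.sum_sigma', Finset.sum_sigma']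
  refine Finset.sum_bij' (fun p _ => ⟨p.1.erase p.2, p.2⟩) (fun p _ => ⟨insert p.2 p.1, p.2⟩)
    ?_ ?_ ?_ ?_ ?_
  · rintro ⟨J, j⟩ h
    simp
  · rintro ⟨J, j⟩ h
    simp
  · rintro ⟨J, j⟩ h
    simp only [Finset.mem_sigma, Finset.mem_univ, true_and] at h
    simp [Finset.insert_erase h]
  · rintro ⟨J, j⟩ h
    simp only [Finset.mem_sigma, Finset.mem_univ, true_and, Finset.mem_compl] at h
    simp [Finset.erase_insert h]
  · rintro ⟨J, j⟩ h
    simp only [Finset.mem_sigma, Finset.mem_univ, true_and] at h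
    simp [Finset.insert_erase h]

lemma inner_extD (D : Fin n → Ext n) (ψ : Ext n) :
    inner ℝ (extD D) ψ = ∑ I, ∑ j ∈ Iᶜ, sign j I * D j I * ψ (insert j I) := by
  rw [inner_ext]
  simp only [extD, Finset.sum_mul]
  rw [sum_erase_eq_sum_insert fun j J I => sign j J * D j I * ψ J]
  simp only [sign_insert]

/-- The basis form `dx^I`. -/
def basisForm (I : Finset (Fin n)) : Ext n := EuclideanSpace.single I 1

lemma basisForm_apply (I J : Finset (Fin n)) : basisForm I J = if J = I then 1 else 0 := by
  simp [basisForm, PiLp.single_apply]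

lemma norm_basisForm (I : Finset (Fin n)) : ‖basisForm I‖ = 1 := by simp [basisForm]

lemma inner_basisForm (I : Finset (Fin n)) (ψ : Ext n) : inner ℝ (basisForm I) ψ = ψ I := by
  simp [inner_ext, basisForm_apply]

lemma basisForm_homogeneous (I : Finset (Fin n)) (c : ℝ) :
    IsHomogeneous I.card (c • basisForm I) := by
  intro J hJ
  rw [PiLp.smul_apply, basisForm_apply, if_neg, smul_zero]
  rintro rfl
  exact hJ rfl

lemma inner_extD_basisForm (a : Fin n → ℝ) (I : Finset (Fin n)) (ψ : Ext n) :
    inner ℝ (extD fun j => a j • basisForm I) ψ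
      = ∑ j ∈ Iᶜ, sign j I * a j * ψ (insert j I) := by
  rw [inner_extD, Finset.sum_eq_single I]
  · simp [basisForm_apply]
  · intro J _ hJ
    simp [basisForm_apply, hJ]
  · simp

lemma extD_basisForm_insert (a : Fin n → ℝ) {I : Finset (Fin n)} {j : Fin n} (hj : j ∉ I) :
    extD (fun j => a j • basisForm I) (insert j I) = sign j I * a j := by
  simp only [extD]
  rw [Finset.sum_eq_single j]
  · simp [sign_insert, basisForm_apply, Finset.erase_insert hj]
  · intro i _ hij
    have : (insert j I).erase i ≠ I := by
      intro h
      apply hj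
      rw [← h]
      simp [hij.symm]
    simp [basisForm_apply, this]
  · simp

/-- Distinct `j ∉ I` give distinct, hence orthonormal, forms `dx^(I ∪ {j})`, while `j ∈ I`
contributes nothing. -/
lemma norm_sq_extD_basisForm (a : Fin n → ℝ) (I : Finset (Fin n)) :
    ‖extD fun j => a j • basisForm I‖ ^ 2 = ∑ j ∈ Iᶜ, a j ^ 2 := by
  rw [← real_inner_self_eq_norm_sq, inner_extD_basisForm]
  refine Finset.sum_congr rfl fun j hj => ?_
  rw [extD_basisForm_insert a (Finset.mem_compl.1 hj)]
  linear_combination a j ^ 2 * sign_mul_self j I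

lemma hodge_smul_basisForm (c : ℝ) (I : Finset (Fin n)) :
    hodge n (c • basisForm I) = (hodgeSign Iᶜ * c) • basisForm Iᶜ := by
  ext J
  rw [hodge_apply, PiLp.smul_apply, PiLp.smul_apply, basisForm_apply, basisForm_apply]
  by_cases h : J = Iᶜ
  · subst h
    simp
  · have : Jᶜ ≠ I := fun h' => h (by rw [← h', compl_compl])
    simp [h, this]

lemma norm_sq_coD_basisForm (a : Fin n → ℝ) (I : Finset (Fin n)) :
    ‖coD fun j => a j • basisForm I‖ ^ 2 = ∑ j ∈ I, a j ^ 2 := by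
  rw [← (hodge n).norm_map, ← extD_hodge]
  simp only [hodge_smul_basisForm]
  rw [norm_sq_extD_basisForm, compl_compl]
  refine Finset.sum_congr rfl fun j _ => ?_
  linear_combination a j ^ 2 * hodgeSign_mul_self Iᶜ

lemma norm_sq_extD_add_norm_sq_coD_basisForm (a : Fin n → ℝ) (I : Finset (Fin n)) :
    ‖extD fun j => a j • basisForm I‖ ^ 2 + ‖coD fun j => a j • basisForm I‖ ^ 2
      = ∑ j, ‖a j • basisForm I‖ ^ 2 := by
  rw [norm_sq_extD_basisForm, norm_sq_coD_basisForm, Finset.sum_compl_add_sum]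
  simp [norm_smul, norm_basisForm]

lemma norm_sq_extD_of_homogeneous_zero {D : Fin n → Ext n} (h : ∀ j, IsHomogeneous 0 (D j)) :
    ‖extD D‖ ^ 2 = ∑ j, ‖D j‖ ^ 2 := by
  have key : D = fun j => (D j ∅) • basisForm ∅ := by
    funext j
    ext J
    rw [PiLp.smul_apply, basisForm_apply]
    by_cases hJ : J = ∅
    · simp [hJ]
    · rw [h j J (by simpa using hJ)]
      simp [hJ]
  rw [key, norm_sq_extD_basisForm]
  simp [norm_smul, norm_basisForm]

/-! ### Hodge duality -/

namespace SobolevForm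

variable {k m : ℕ} {Ω : Set (Space n)}

/-- The Hodge star operator on Sobolev forms. -/
def star (hkm : k + m = n) (ω : SobolevForm Ω k) : SobolevForm Ω m where
  toFun x := hodge n (ω.toFun x)
  grad j x := hodge n (ω.grad j x)
  homogeneous x := hodge_homogeneous hkm (ω.homogeneous x)
  grad_homogeneous j x := hodge_homogeneous hkm (ω.grad_homogeneous j x)
  memLp := (hodge n).toContinuousLinearMap.comp_memLp' ω.memLp
  grad_memLp j := (hodge n).toContinuousLinearMap.comp_memLp' (ω.grad_memLp j)
  isWeakPartial j φ h1 h2 h3 := by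
    simp only [← map_smul]
    rw [LinearIsometry.integral_comp_comm, LinearIsometry.integral_comp_comm,
      ω.isWeakPartial j φ h1 h2 h3, map_neg]

lemma star_d (hkm : k + m = n) (ω : SobolevForm Ω k) (x : Space n) :
    (ω.star hkm).d x = hodge n (ω.δ x) := extD_hodge _

lemma star_δ (hkm : k + m = n) (ω : SobolevForm Ω k) (x : Space n) :
    (ω.star hkm).δ x = hodge n (ω.d x) := coD_hodge _

lemma isNonzero_star (hkm : k + m = n) {ω : SobolevForm Ω k} (h : ω.IsNonzero) :
    (ω.star hkm).IsNonzero := by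
  intro h'
  apply h
  filter_upwards [h'] with x hx
  exact (map_eq_zero_iff _ (hodge n).injective).1 hx

lemma isNormal_star (hkm : k + m = n) {ω : SobolevForm Ω k} (h : ω.IsTangential) :
    (ω.star hkm).IsNormal := by
  intro l hl φ
  have h1 := h (φ.star (show l + (k + 1) = n by omega))
  simp only [star_δ] at h1 ⊢
  simp only [star] at h1 ⊢
  simp only [inner_hodge_left, ← mul_add]
  rw [integral_const_mul, h1, mul_zero]

lemma coD_zero : coD (fun _ => 0 : Fin n → Ext n) = 0 := by
  ext J
  simp [coD]

lemma _root_.Gaffney.IsHomogeneous.eq_zero_of_lt (hk : n < k) {ω : Ext n}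
    (h : IsHomogeneous k ω) : ω = 0 := by
  ext I
  refine h I (ne_of_lt (lt_of_le_of_lt ?_ hk))
  simpa using I.card_le_univ

lemma isTangential_star (hkm : k + m = n) {ω : SobolevForm Ω k} (h : ω.IsNormal) :
    (ω.star hkm).IsTangential := by
  intro φ
  cases k with
  -- `IsNormal` is empty in degree `0`, but here `m = n`, so the test form has degree `n + 1` and
  -- vanishes.
  | zero =>
    have h1 : ∀ x, φ.toFun x = 0 := fun x => (φ.homogeneous x).eq_zero_of_lt (by omega)
    have h2 : ∀ x, φ.δ x = 0 := fun x => by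
      have : (fun j => φ.grad j x) = fun _ => 0 :=
        funext fun j => (φ.grad_homogeneous j x).eq_zero_of_lt (by omega)
      rw [δ, this, coD_zero]
    simp [h1, h2]
  | succ l =>
    have h1 := h l rfl (φ.star (show m + 1 + l = n by omega))
    simp only [star_d] at h1 ⊢
    simp only [star] at h1 ⊢
    simp only [inner_hodge_left, ← mul_add]
    rw [integral_const_mul, h1, mul_zero]

lemma quotient_star (hkm : k + m = n) (ω : SobolevForm Ω k) :
    quotient (ω.star hkm) = quotient ω := by
  have h1 : ∀ f : Space n → Ext n, normSq Ω (fun x => hodge n (f x)) = normSq Ω f := fun f => by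
    simp only [normSq, LinearIsometry.enorm_map]
  have h2 : (ω.star hkm).d = fun x => hodge n (ω.δ x) := funext (star_d hkm ω)
  have h3 : (ω.star hkm).δ = fun x => hodge n (ω.d x) := funext (star_δ hkm ω)
  unfold quotient
  rw [h2, h3]
  simp only [star, h1]
  rw [add_comm (normSq Ω ω.δ)]

end SobolevForm

/-- Hodge duality exchanges the two boundary conditions. -/
theorem bestT_eq_bestN {k m : ℕ} (hkm : k + m = n) (Ω : Set (Space n)) :
    bestT Ω k = bestN Ω m := by
  apply le_antisymm
  · refine iSup_le fun ω => iSup₂_le fun h1 h2 => ?_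
    rw [← ω.quotient_star hkm]
    exact le_iSup_of_le (ω.star hkm) (le_iSup₂_of_le (SobolevForm.isNormal_star hkm h1)
      (SobolevForm.isNonzero_star hkm h2) le_rfl)
  · have hmk : m + k = n := by omega
    refine iSup_le fun ω => iSup₂_le fun h1 h2 => ?_
    rw [← ω.quotient_star hmk]
    exact le_iSup_of_le (ω.star hmk) (le_iSup₂_of_le (SobolevForm.isTangential_star hmk h1)
      (SobolevForm.isNonzero_star hmk h2) le_rfl)

/-! ### Degree zero -/

section

variable {k : ℕ} {Ω : Set (Space n)}

lemma aemeasurable_enorm_sq {f : Space n → Ext n} (h : MemLp f 2 (volume.restrict Ω)) :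
    AEMeasurable (fun x => ‖f x‖ₑ ^ 2) (volume.restrict Ω) :=
  h.1.enorm.pow_const 2

lemma enorm_sq_eq_ofReal (v : Ext n) : ‖v‖ₑ ^ 2 = ENNReal.ofReal (‖v‖ ^ 2) := by
  rw [ENNReal.ofReal_pow (norm_nonneg _), ofReal_norm]

lemma sum_normSq_grad (ω : SobolevForm Ω k) :
    ∑ j, normSq Ω (ω.grad j) = ∫⁻ x in Ω, ENNReal.ofReal (∑ j, ‖ω.grad j x‖ ^ 2) := by
  unfold normSq
  rw [← lintegral_finsetSum' _ fun j _ => aemeasurable_enorm_sq (ω.grad_memLp j)]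
  refine lintegral_congr fun x => ?_
  rw [ENNReal.ofReal_sum_of_nonneg fun j _ => sq_nonneg _]
  simp only [enorm_sq_eq_ofReal]

lemma quotient_le_one_of_degree_zero (ω : SobolevForm Ω 0) : quotient ω ≤ 1 := by
  refine ENNReal.div_le_of_le_mul ?_
  rw [one_mul, add_assoc]
  refine le_trans (le_of_eq ?_) le_self_add
  rw [sum_normSq_grad]
  refine lintegral_congr fun x => ?_
  rw [SobolevForm.d, enorm_sq_eq_ofReal,
    norm_sq_extD_of_homogeneous_zero fun j => ω.grad_homogeneous j x]

theorem bestT_zero_le (Ω : Set (Space n)) : bestT Ω 0 ≤ 1 :=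
  iSup_le fun ω => iSup₂_le fun _ _ => quotient_le_one_of_degree_zero ω

theorem bestN_zero_le (Ω : Set (Space n)) : bestN Ω 0 ≤ 1 :=
  iSup_le fun ω => iSup₂_le fun _ _ => quotient_le_one_of_degree_zero ω

end

/-! ### Compactly supported forms -/

section bump

/-- The partial derivative `∂ⱼf`. -/
def partialDeriv (f : Space n → ℝ) (j : Fin n) (x : Space n) : ℝ :=
  fderiv ℝ f x (EuclideanSpace.single j 1)

variable {f : Space n → ℝ}

lemma continuous_partialDeriv (hf : ContDiff ℝ ((⊤ : ℕ∞) : WithTop ℕ∞) f) (j : Fin n) :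
    Continuous (partialDeriv f j) :=
  (hf.continuous_fderiv (by simp)).clm_apply continuous_const

lemma hasCompactSupport_partialDeriv (hc : HasCompactSupport f) (j : Fin n) :
    HasCompactSupport (partialDeriv f j) :=
  hc.fderiv_apply (𝕜 := ℝ) _

lemma partialDeriv_eq_zero {x : Space n} (hx : x ∉ tsupport f) (j : Fin n) :
    partialDeriv f j x = 0 := by
  have : fderiv ℝ f x = 0 := by
    by_contra h
    exact hx (support_fderiv_subset ℝ h)
  simp [partialDeriv, this]

/-- Compact support is asked of `g` alone, so that `f` may be a coordinate function in
`integral_sq_le`. -/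
lemma integral_partialDeriv_mul {g : Space n → ℝ} (hf : ContDiff ℝ ((⊤ : ℕ∞) : WithTop ℕ∞) f)
    (hg : ContDiff ℝ ((⊤ : ℕ∞) : WithTop ℕ∞) g) (hc : HasCompactSupport g) (j : Fin n) :
    ∫ x, f x * partialDeriv g j x = - ∫ x, partialDeriv f j x * g x := by
  refine integral_mul_fderiv_eq_neg_fderiv_mul_of_integrable ?_ ?_ ?_ ?_ ?_
  · exact ((continuous_partialDeriv hf j).mul hg.continuous).integrable_of_hasCompactSupport
      hc.mul_left
  · exact (hf.continuous.mul (continuous_partialDeriv hg j)).integrable_of_hasCompactSupport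
      (hasCompactSupport_partialDeriv hc j).mul_left
  · exact (hf.continuous.mul hg.continuous).integrable_of_hasCompactSupport hc.mul_left
  · exact fun x _ => hf.differentiable (by simp) x
  · exact fun x _ => hg.differentiable (by simp) x

variable {Ω : Set (Space n)}

/-- The form `f dx^I` for a test function `f`. -/
def testForm (hf : ContDiff ℝ ((⊤ : ℕ∞) : WithTop ℕ∞) f) (hc : HasCompactSupport f)
    (hs : tsupport f ⊆ Ω) (I : Finset (Fin n)) : SobolevForm Ω I.card where
  toFun x := f x • basisForm I
  grad j x := partialDeriv f j x • basisForm I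
  homogeneous x := basisForm_homogeneous I _
  grad_homogeneous j x := basisForm_homogeneous I _
  memLp := ((hf.continuous.smul continuous_const).memLp_of_hasCompactSupport
    hc.smul_right).restrict Ω
  grad_memLp j := (((continuous_partialDeriv hf j).smul continuous_const).memLp_of_hasCompactSupport
    (hasCompactSupport_partialDeriv hc j).smul_right).restrict Ω
  isWeakPartial j φ h1 h2 h3 := by
    have hz : ∀ x, x ∉ Ω → f x = 0 := fun x hx => image_eq_zero_of_notMem_tsupport fun h => hx (hs h)
    have hz' : ∀ x, x ∉ Ω → partialDeriv f j x = 0 :=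
      fun x hx => partialDeriv_eq_zero (fun h => hx (hs h)) j
    simp only [smul_smul]
    rw [integral_smul_const, integral_smul_const, ← neg_smul]
    congr 1
    rw [setIntegral_eq_integral_of_forall_compl_eq_zero fun x hx => by rw [hz x hx, mul_zero],
      setIntegral_eq_integral_of_forall_compl_eq_zero fun x hx => by rw [hz' x hx, mul_zero]]
    rw [integral_partialDeriv_mul h1 hf hc j, neg_neg]
    rfl

/-- The Green integrand is a signed sum of components of `∂ⱼf φ + f ∂ⱼφ`. Each integrates to zero by
the definition of the weak derivative of `φ`, tested against `f`, so no regularity of `∂Ω` is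
involved. -/
lemma isTangential_testForm (hf : ContDiff ℝ ((⊤ : ℕ∞) : WithTop ℕ∞) f)
    (hc : HasCompactSupport f) (hs : tsupport f ⊆ Ω) (I : Finset (Fin n)) :
    (testForm hf hc hs I).IsTangential := by
  intro φ
  have hf2 : MemLp f 2 (volume.restrict Ω) :=
    (hf.continuous.memLp_of_hasCompactSupport hc).restrict Ω
  have hf2' : ∀ j, MemLp (partialDeriv f j) 2 (volume.restrict Ω) := fun j =>
    ((continuous_partialDeriv hf j).memLp_of_hasCompactSupport
      (hasCompactSupport_partialDeriv hc j)).restrict Ω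
  have i1 : ∀ j, Integrable (fun x => partialDeriv f j x • φ.toFun x) (volume.restrict Ω) :=
    fun j => memLp_one_iff_integrable.1 (MemLp.smul φ.memLp (hf2' j))
  have i2 : ∀ j, Integrable (fun x => f x • φ.grad j x) (volume.restrict Ω) :=
    fun j => memLp_one_iff_integrable.1 (MemLp.smul (φ.grad_memLp j) hf2)
  have i3 : ∀ j (J : Finset (Fin n)), Integrable (fun x =>
      (partialDeriv f j x • φ.toFun x + f x • φ.grad j x : Ext n) J) (volume.restrict Ω) :=
    fun j J => (EuclideanSpace.proj (𝕜 := ℝ) J : Ext n →L[ℝ] ℝ).integrable_comp ((i1 j).add (i2 j))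
  have hpt : ∀ x, inner ℝ ((testForm hf hc hs I).d x) (φ.toFun x)
      + inner ℝ ((testForm hf hc hs I).toFun x) (φ.δ x)
      = ∑ j ∈ Iᶜ, sign j I *
        (partialDeriv f j x • φ.toFun x + f x • φ.grad j x : Ext n) (insert j I) := by
    intro x
    simp only [testForm, SobolevForm.d, SobolevForm.δ]
    rw [inner_extD_basisForm, real_inner_smul_left, inner_basisForm]
    simp only [coD]
    rw [Finset.mul_sum, ← Finset.sum_add_distrib]
    refine Finset.sum_congr rfl fun j _ => ?_
    simp only [PiLp.add_apply, PiLp.smul_apply, smul_eq_mul]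
    ring
  simp only [hpt]
  rw [integral_finsetSum _ fun j _ => (i3 j (insert j I)).const_mul (sign j I)]
  refine Finset.sum_eq_zero fun j _ => ?_
  rw [integral_const_mul]
  have h0 : ∫ x in Ω, (partialDeriv f j x • φ.toFun x + f x • φ.grad j x) = 0 := by
    rw [integral_add (i1 j) (i2 j)]
    exact eq_neg_iff_add_eq_zero.1 (φ.isWeakPartial j f hf hc hs)
  have h1 := (EuclideanSpace.proj (𝕜 := ℝ) (insert j I) : Ext n →L[ℝ] ℝ).integral_comp_comm
    ((i1 j).add (i2 j))
  simp only [Pi.add_apply, h0, map_zero, EuclideanSpace.coe_proj] at h1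
  rw [h1, mul_zero]

/-- Poincaré inequality: since `∂ⱼ(xⱼ - cⱼ) = 1`, integration by parts gives `∫ f² = -∫ 2 (xⱼ - cⱼ)
f ∂ⱼf`, and `|xⱼ - cⱼ| ≤ ε` on the support. -/
lemma integral_sq_le (hf : ContDiff ℝ ((⊤ : ℕ∞) : WithTop ℕ∞) f)
    (hc : HasCompactSupport f) (j : Fin n) {c : Space n} {ε : ℝ}
    (hs : tsupport f ⊆ Metric.ball c ε) :
    ∫ x, f x ^ 2 ≤ 4 * ε ^ 2 * ∫ x, partialDeriv f j x ^ 2 := by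
  have hp : ContDiff ℝ ((⊤ : ℕ∞) : WithTop ℕ∞) fun x : Space n => x j - c j := by fun_prop
  have hp' : ∀ x, partialDeriv (fun x : Space n => x j - c j) j x = 1 := by
    intro x
    have : HasFDerivAt (fun x : Space n => x j - c j)
        (EuclideanSpace.proj (𝕜 := ℝ) j : Space n →L[ℝ] ℝ) x :=
      (EuclideanSpace.proj (𝕜 := ℝ) j : Space n →L[ℝ] ℝ).hasFDerivAt.sub_const _
    simp [partialDeriv, this.fderiv]
  have hq' : ∀ x, partialDeriv (fun x => f x ^ 2) j x = 2 * f x * partialDeriv f j x := by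
    intro x
    have : HasFDerivAt (fun x => f x ^ 2) _ x :=
      (hf.differentiable (by simp) x).hasFDerivAt.pow 2
    simp [partialDeriv, this.fderiv]
  have hc2 : HasCompactSupport fun x => f x ^ 2 := hc.comp_left (g := fun t => t ^ 2) (by simp)
  have h := integral_partialDeriv_mul hp (hf.pow 2) hc2 j
  simp only [hp', hq', one_mul] at h
  have hcd := hasCompactSupport_partialDeriv hc j
  have hcd2 : HasCompactSupport fun x => partialDeriv f j x ^ 2 :=
    hcd.comp_left (g := fun t => t ^ 2) (by simp)
  have j1 : Integrable fun x => f x ^ 2 :=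
    (hf.continuous.pow 2).integrable_of_hasCompactSupport hc2
  have j2 : Integrable fun x => partialDeriv f j x ^ 2 :=
    ((continuous_partialDeriv hf j).pow 2).integrable_of_hasCompactSupport hcd2
  -- Young's inequality with weight `1/2` on `f²`, which is absorbed on the left and yields the
  -- constant `4`.
  have hle : ∫ x, f x ^ 2 ≤ ∫ x, (1 / 2 * f x ^ 2 + 2 * ε ^ 2 * partialDeriv f j x ^ 2) := by
    rw [← neg_neg (∫ x, f x ^ 2), ← h, ← integral_neg]
    refine integral_mono (Integrable.neg ?_) ((j1.const_mul _).add (j2.const_mul _)) ?_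
    · exact (hp.continuous.mul ((continuous_const.mul hf.continuous).mul
        (continuous_partialDeriv hf j))).integrable_of_hasCompactSupport (hcd.mul_left.mul_left)
    · intro x
      simp only
      by_cases hx : x ∈ tsupport f
      · have h1 : (x j - c j) ^ 2 ≤ ε ^ 2 := by
          have h2 : |x j - c j| ≤ ε := by
            refine le_trans ?_ (Metric.mem_ball.1 (hs hx)).le
            rw [dist_eq_norm]
            exact PiLp.norm_apply_le (x - c) j
          exact sq_le_sq.2 (h2.trans (le_abs_self ε))
        nlinarith [sq_nonneg (f x + 2 * (x j - c j) * partialDeriv f j x),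
          mul_le_mul_of_nonneg_right h1 (sq_nonneg (partialDeriv f j x))]
      · rw [image_eq_zero_of_notMem_tsupport hx, partialDeriv_eq_zero hx j]
        simp
  rw [integral_add (j1.const_mul _) (j2.const_mul _), integral_const_mul, integral_const_mul] at hle
  linarith

lemma normSq_smul_basisForm {g : Space n → ℝ} (hg : Continuous g) (hc : HasCompactSupport g)
    (hs : ∀ x, x ∉ Ω → g x = 0) (I : Finset (Fin n)) :
    normSq Ω (fun x => g x • basisForm I) = ENNReal.ofReal (∫ x, g x ^ 2) := by
  have hc2 : HasCompactSupport fun x => g x ^ 2 := hc.comp_left (g := fun t => t ^ 2) (by simp)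
  have h1 : Integrable (fun x => g x ^ 2) (volume.restrict Ω) :=
    ((hg.pow 2).integrable_of_hasCompactSupport hc2).restrict
  have h2 : ∀ x, x ∉ Ω → g x ^ 2 = 0 := fun x hx => by rw [hs x hx, zero_pow two_ne_zero]
  rw [← setIntegral_eq_integral_of_forall_compl_eq_zero h2,
    ofReal_integral_eq_lintegral_ofReal h1 (Filter.Eventually.of_forall fun x => sq_nonneg _)]
  refine lintegral_congr fun x => ?_
  rw [enorm_sq_eq_ofReal, norm_smul, norm_basisForm, mul_one, Real.norm_eq_abs, sq_abs]

lemma normSq_d_add_normSq_δ_testForm (hf : ContDiff ℝ ((⊤ : ℕ∞) : WithTop ℕ∞) f)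
    (hc : HasCompactSupport f) (hs : tsupport f ⊆ Ω) (I : Finset (Fin n)) :
    normSq Ω (testForm hf hc hs I).d + normSq Ω (testForm hf hc hs I).δ
      = ∑ j, normSq Ω ((testForm hf hc hs I).grad j) := by
  rw [sum_normSq_grad]
  have hd : Continuous (testForm hf hc hs I).d := by
    refine (PiLp.continuous_toLp 2 _).comp (continuous_pi fun J => ?_)
    refine continuous_finsetSum _ fun j _ => continuous_const.mul ?_
    simp only [testForm, PiLp.smul_apply, smul_eq_mul]
    exact (continuous_partialDeriv hf j).mul continuous_const
  unfold normSq
  rw [← lintegral_add_left (hd.enorm.measurable.pow_const 2)]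
  refine lintegral_congr fun x => ?_
  rw [enorm_sq_eq_ofReal, enorm_sq_eq_ofReal, ← ENNReal.ofReal_add (sq_nonneg _) (sq_nonneg _)]
  exact congrArg _ (norm_sq_extD_add_norm_sq_coD_basisForm (fun j => partialDeriv f j x) I)

/-- A form `f dx^I` with `f` supported in a small ball has quotient close to `1`. -/
lemma le_bestT_of_ball_subset (hn : 1 ≤ n) {k : ℕ} (hk : k ≤ n) {c : Space n} {ε : ℝ} (hε : 0 < ε)
    (hb : Metric.ball c ε ⊆ Ω) : (1 + ENNReal.ofReal (4 * ε ^ 2))⁻¹ ≤ bestT Ω k := by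
  obtain ⟨I, hI⟩ : ∃ I : Finset (Fin n), I.card = k := by
    obtain ⟨I, -, hI⟩ := Finset.exists_subset_card_eq (s := (Finset.univ : Finset (Fin n)))
      (n := k) (by simpa using hk)
    exact ⟨I, hI⟩
  subst hI
  let η : ContDiffBump c := ⟨ε / 4, ε / 2, by positivity, by linarith⟩
  have hf : ContDiff ℝ ((⊤ : ℕ∞) : WithTop ℕ∞) η := η.contDiff
  have hc : HasCompactSupport η := η.hasCompactSupport
  have hsb : tsupport η ⊆ Metric.ball c ε := by
    rw [η.tsupport_eq]
    exact Metric.closedBall_subset_ball (by change ε / 2 < ε; linarith)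
  have hs := hsb.trans hb
  have hz : ∀ x, x ∉ Ω → η x = 0 := fun x hx => image_eq_zero_of_notMem_tsupport fun h => hx (hs h)
  have hz' : ∀ j x, x ∉ Ω → partialDeriv η j x = 0 :=
    fun j x hx => partialDeriv_eq_zero (fun h => hx (hs h)) j
  set ω := testForm hf hc hs I with hω
  set F := normSq Ω ω.toFun with hF
  set G := ∑ j, normSq Ω (ω.grad j) with hG
  have hFeq : F = ENNReal.ofReal (∫ x, η x ^ 2) := normSq_smul_basisForm hf.continuous hc hz I
  have hGj : ∀ j, normSq Ω (ω.grad j) = ENNReal.ofReal (∫ x, partialDeriv η j x ^ 2) := fun j =>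
    normSq_smul_basisForm (continuous_partialDeriv hf j) (hasCompactSupport_partialDeriv hc j)
      (hz' j) I
  have hFpos : 0 < ∫ x, η x ^ 2 := by
    have hc2 : HasCompactSupport fun x => η x ^ 2 := hc.comp_left (g := fun t => t ^ 2) (by simp)
    refine (hf.continuous.pow 2).integral_pos_of_hasCompactSupport_nonneg_nonzero hc2
      (fun x => sq_nonneg _) (x := c) ?_
    exact pow_ne_zero 2 (η.pos_of_mem_ball (Metric.mem_ball_self η.rOut_pos)).ne'
  have hFG : F ≤ ENNReal.ofReal (4 * ε ^ 2) * G := by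
    -- One direction suffices for Poincaré; `1 ≤ n` provides it.
    let j : Fin n := ⟨0, hn⟩
    refine le_trans ?_ (mul_le_mul_right (Finset.single_le_sum (f := fun j => normSq Ω (ω.grad j))
      (fun _ _ => zero_le) (Finset.mem_univ j)) _)
    rw [hFeq]
    simp only [hGj]
    rw [← ENNReal.ofReal_mul (by positivity)]
    exact ENNReal.ofReal_le_ofReal (integral_sq_le hf hc j hsb)
  have hF0 : F ≠ 0 := by rw [hFeq]; simpa using hFpos
  -- Together with `G ≠ ∞`, this allows cancelling `G` in `ℝ≥0∞` below.
  have hG0 : G ≠ 0 := by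
    intro h
    rw [h, mul_zero] at hFG
    exact hF0 (le_antisymm hFG zero_le)
  have hGt : G ≠ ∞ := by
    rw [hG]
    simp only [hGj]
    exact ENNReal.sum_ne_top.2 fun _ _ => ENNReal.ofReal_ne_top
  have hnz : ω.IsNonzero := by
    intro h
    apply hF0
    rw [hF, normSq, lintegral_congr_ae (g := fun _ => 0), lintegral_zero]
    filter_upwards [h] with x hx
    simp [hx]
  refine le_trans ?_ (le_iSup_of_le ω (le_iSup₂_of_le (isTangential_testForm hf hc hs I) hnz le_rfl))
  rw [quotient, normSq_d_add_normSq_δ_testForm]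
  change _ ≤ G / (G + F)
  calc (1 + ENNReal.ofReal (4 * ε ^ 2))⁻¹
      = G / ((1 + ENNReal.ofReal (4 * ε ^ 2)) * G) := by
        rw [ENNReal.div_eq_inv_mul, ENNReal.mul_inv (Or.inr hGt) (Or.inr hG0), mul_assoc,
          ENNReal.inv_mul_cancel hG0 hGt, mul_one]
    _ ≤ G / (G + F) := by
        refine ENNReal.div_le_div_left ?_ _
        rw [add_mul, one_mul]
        gcongr

end bump

/-- Balls shrinking to one point of `Ω` give lower bounds tending to `1`; the supremum need not be
attained. -/
theorem one_le_bestT (hn : 1 ≤ n) {k : ℕ} (hk : k ≤ n) {Ω : Set (Space n)} (hΩo : IsOpen Ω)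
    (hΩn : Ω.Nonempty) : 1 ≤ bestT Ω k := by
  obtain ⟨c, hc⟩ := hΩn
  obtain ⟨r, hr, hb⟩ := Metric.isOpen_iff.1 hΩo c hc
  have hlim : Filter.Tendsto (fun ε : ℝ => (1 + ENNReal.ofReal (4 * ε ^ 2))⁻¹)
      (nhdsWithin 0 (Set.Ioi 0)) (nhds 1) := by
    have h : Continuous fun ε : ℝ => (1 + ENNReal.ofReal (4 * ε ^ 2))⁻¹ :=
      (continuous_const.add (ENNReal.continuous_ofReal.comp (by fun_prop))).inv
    have := h.tendsto 0
    simp only [ne_eq, OfNat.ofNat_ne_zero, not_false_eq_true, zero_pow, mul_zero,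
      ENNReal.ofReal_zero, add_zero, inv_one] at this
    exact this.mono_left nhdsWithin_le_nhds
  refine le_of_tendsto hlim ?_
  filter_upwards [Ioo_mem_nhdsGT hr] with ε hε
  exact le_bestT_of_ball_subset hn hk hε.1 ((Metric.ball_subset_ball hε.2.le).trans hb)

end

end Gaffney

theorem proposition3p1 (n : ℕ) (hn : 1 ≤ n) (Ω : Set (Gaffney.Space n)) (hΩo : IsOpen Ω)
    (hΩb : Bornology.IsBounded Ω) (hΩn : Ω.Nonempty) (k : ℕ) (hk : k ≤ n) :
    (1 ≤ Gaffney.bestT Ω k ∧ 1 ≤ Gaffney.bestN Ω k) ∧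
    (Gaffney.bestT Ω 0 = 1 ∧ Gaffney.bestN Ω 0 = 1 ∧
      Gaffney.bestT Ω n = 1 ∧ Gaffney.bestN Ω n = 1) ∧
    Gaffney.bestT Ω k = Gaffney.bestN Ω (n - k) := by
  have hT : ∀ {m : ℕ}, m ≤ n → 1 ≤ Gaffney.bestT Ω m :=
    fun hm => Gaffney.one_le_bestT hn hm hΩo hΩn
  have hN : ∀ {m : ℕ}, m ≤ n → 1 ≤ Gaffney.bestN Ω m := fun {m} hm => by
    rw [← Gaffney.bestT_eq_bestN (show n - m + m = n by omega)]
    exact hT (Nat.sub_le _ _)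
  have hT0 := le_antisymm (Gaffney.bestT_zero_le Ω) (hT (Nat.zero_le n))
  have hN0 := le_antisymm (Gaffney.bestN_zero_le Ω) (hN (Nat.zero_le n))
  refine ⟨⟨hT hk, hN hk⟩, ⟨hT0, hN0, ?_, ?_⟩, Gaffney.bestT_eq_bestN (by omega) Ω⟩
  · rw [Gaffney.bestT_eq_bestN (add_zero n), hN0]
  · rw [← Gaffney.bestT_eq_bestN (zero_add n), hT0]
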